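/- Let $k$ be a field, let $r\ge 1$ be an integer, and let $B=k\langle x,y\rangle/(y^{r+1})$ with the $\mathbb Z$-grading $\deg x=\deg y=1$ (the case $r=1$ is $B=k\langle x,y\rangle/(y^2)$). Let ${\sf Gr}\,B$ be the category of $\mathbb Z$-graded left $B$-modules with degree-preserving homomorphisms, let ${\sf Fdim}\,B$ be its Serre subcategory of modules that are unions of their finite-dimensional graded submodules, and let ${\sf QGr}\,B={\sf Gr}\,B/{\sf Fdim}\,B$ be the quotient category, i.e. the category of quasi-coherent sheaves on the non-commutative scheme $\operatorname{Proj}_{nc}B$. A closed subspace of $\operatorname{Proj}_{nc}B$ is a full subcategory of ${\sf QGr}\,B$ that is closed under subobjects and quotients (hence under isomorphisms) and whose inclusion functor has both a right adjoint and a left adjoint. Then the only closed subspaces of $\operatorname{Proj}_{nc}B$ are $\operatorname{Proj}_{nc}B$ itself and the empty set: a full subcategory of ${\sf QGr}\,B$ is a closed subspace if and only if it is all of ${\sf QGr}\,B$ or it consists exactly of the zero objects. -/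

import Mathlib

open CategoryTheory CategoryTheory.Limits
universe u v
namespace NCProj

noncomputable section Algebra
variable (k : Type u) [Field k] (r : ℕ)

/-- The single relation `y ^ (r + 1) = 0` on the free algebra `k⟨x, y⟩`, where `x` and `y` are the
generators with index `0` and `1`. -/
def Rel (a b : FreeAlgebra k (Fin 2)) : Prop :=
  a = FreeAlgebra.ι k 1 ^ (r + 1) ∧ b = 0

/-- The algebra `B = k⟨x, y⟩ / (y ^ (r + 1))`. -/
abbrev B : Type u := RingQuot (Rel k r)

/-- The generators of `B`: `gen 0` is `x`, `gen 1` is `y`. -/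
def gen (a : Fin 2) : B k r := RingQuot.mkAlgHom k (Rel k r) (FreeAlgebra.ι k a)

/-- The monomial in `B` given by a word in `x` and `y`. -/
def word (w : List (Fin 2)) : B k r := (w.map (gen k r)).prod

/-- The homogeneous component of degree `n` of `B` for the `ℤ`-grading with `deg x = deg y = 1`:
the span of the words of length `n`. -/
def grading (n : ℤ) : Submodule k (B k r) :=
  Submodule.span k {b | ∃ w : List (Fin 2), (w.length : ℤ) = n ∧ word k r w = b}

lemma word_mem (w : List (Fin 2)) : word k r w ∈ grading k r w.length :=
  Submodule.subset_span ⟨w, rfl, rfl⟩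

lemma gen_mem (a : Fin 2) : gen k r a ∈ grading k r 1 := by
  simpa [word] using word_mem k r [a]

lemma word_append (w w' : List (Fin 2)) : word k r (w ++ w') = word k r w * word k r w' := by
  simp [word]

instance : SetLike.GradedMonoid (grading k r) where
  one_mem := by simpa [word] using word_mem k r []
  mul_mem := by
    intro i j a b ha hb
    have h := Submodule.mul_mem_mul ha hb
    rw [grading, grading, Submodule.span_mul_span] at h
    refine Submodule.span_mono ?_ h
    rintro _ ⟨_, ⟨w, rfl, rfl⟩, _, ⟨w', rfl, rfl⟩, rfl⟩
    exact ⟨w ++ w', by simp, word_append k r w w'⟩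

/-- Auxiliary: the map from the free algebra that decomposes elements into their components. -/
def decomposeFree : FreeAlgebra k (Fin 2) →ₐ[k] DirectSum ℤ fun i => grading k r i :=
  FreeAlgebra.lift k fun a => DirectSum.of (fun i => grading k r i) 1 ⟨gen k r a, gen_mem k r a⟩

lemma decomposeFree_word (w : List (Fin 2)) :
    decomposeFree k r ((w.map (FreeAlgebra.ι k)).prod) =
      DirectSum.of (fun i => grading k r i) w.length ⟨word k r w, word_mem k r w⟩ := by
  induction w with
  | nil => simp; rfl
  | cons a w ih =>
    rw [List.map_cons, List.prod_cons, map_mul, ih, decomposeFree, FreeAlgebra.lift_ι_apply,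
      DirectSum.of_mul_of]
    refine DirectSum.of_eq_of_gradedMonoid_eq (Sigma.subtype_ext ?_ ?_)
    · exact (by rw [List.length_cons]; push_cast; ring :
        (1 : ℤ) + (w.length : ℤ) = ((a :: w).length : ℤ))
    · exact (by simp [word] : gen k r a * word k r w = word k r (a :: w))

lemma mk_word (w : List (Fin 2)) :
    RingQuot.mkAlgHom k (Rel k r) ((w.map (FreeAlgebra.ι k)).prod) = word k r w := by
  rw [map_list_prod, List.map_map]; rfl

lemma decomposeFree_rel ⦃a b : FreeAlgebra k (Fin 2)⦄ (h : Rel k r a b) :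
    decomposeFree k r a = decomposeFree k r b := by
  obtain ⟨rfl, rfl⟩ := h
  have h1 := decomposeFree_word k r (List.replicate (r + 1) 1)
  have h2 := mk_word k r (List.replicate (r + 1) 1)
  rw [List.map_replicate, List.prod_replicate] at h1 h2
  rw [RingQuot.mkAlgHom_rel (s := Rel k r) k ⟨rfl, rfl⟩, map_zero] at h2
  rw [h1, map_zero]
  have h3 : (⟨word k r (List.replicate (r + 1) 1), word_mem k r _⟩ :
      grading k r (List.replicate (r + 1) (1 : Fin 2)).length) = 0 := Subtype.ext h2.symm
  rw [h3, map_zero]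

/-- Auxiliary: the map that decomposes elements of `B` into their homogeneous components. -/
def decomposeB : B k r →ₐ[k] DirectSum ℤ fun i => grading k r i :=
  RingQuot.liftAlgHom k ⟨decomposeFree k r, decomposeFree_rel k r⟩

lemma decomposeB_word (w : List (Fin 2)) :
    decomposeB k r (word k r w) =
      DirectSum.of (fun i => grading k r i) w.length ⟨word k r w, word_mem k r w⟩ := by
  conv_lhs => rw [← mk_word]
  rw [decomposeB, RingQuot.liftAlgHom_mkAlgHom_apply, decomposeFree_word]

instance : GradedAlgebra (grading k r) :=
  GradedAlgebra.ofAlgHom (grading k r) (decomposeB k r)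
    (by
      apply RingQuot.ringQuot_ext'
      ext a
      have h := decomposeB_word k r [a]
      have e : word k r [a] = RingQuot.mkAlgHom k (Rel k r) (FreeAlgebra.ι k a) := by
        simp [word, gen]
      simp only [Function.comp_apply, AlgHom.id_apply, AlgHom.coe_comp]
      rw [← e, h, DirectSum.coeAlgHom_of])
    (by
      rintro i ⟨x, hx⟩
      dsimp only
      rw [grading] at hx
      induction hx using Submodule.span_induction with
      | mem x h =>
        obtain ⟨w, rfl, rfl⟩ := h
        exact decomposeB_word k r w
      | zero =>
        rw [map_zero]
        exact (map_zero (DirectSum.of (fun i => grading k r i) i)).symm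
      | add x y hx1 hy1 ihx ihy =>
        rw [map_add, ihx hx1, ihy hy1, ← map_add]; rfl
      | smul c x hx1 ih =>
        rw [map_smul, ih hx1]
        exact (map_smul (DirectSum.lof k ℤ (fun i => grading k r i) i) c ⟨x, hx1⟩).symm)

lemma mem_span_words (b : B k r) : b ∈ Submodule.span k (Set.range (word k r)) := by
  have h : b ∈ ⨆ i, grading k r i := by
    rw [((DirectSum.isInternal_submodule_iff_iSupIndep_and_iSup_eq_top _).1
      (DirectSum.Decomposition.isInternal (grading k r))).2]
    trivial
  refine (iSup_le fun i => Submodule.span_mono ?_ : ⨆ i, grading k r i ≤ _) h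
  rintro _ ⟨w, _, rfl⟩
  exact ⟨w, rfl⟩

end Algebra

noncomputable section Graded

lemma isInternal_of_proj {k : Type*} [Field k] {M : Type*} [AddCommGroup M] [Module k M]
    (D : ℤ → Submodule k M) (p : ℤ → M →ₗ[k] M)
    (h1 : ∀ i x, x ∈ D i → p i x = x) (h2 : ∀ i j x, j ≠ i → x ∈ D j → p i x = 0)
    (h3 : ∀ x, x ∈ ⨆ i, D i) : DirectSum.IsInternal D := by
  rw [DirectSum.isInternal_submodule_iff_iSupIndep_and_iSup_eq_top]
  refine ⟨?_, eq_top_iff.2 fun x _ => h3 x⟩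
  rw [iSupIndep_def]
  intro i
  rw [Submodule.disjoint_def]
  intro x hx hx'
  have hle : (⨆ j, ⨆ (_ : j ≠ i), D j) ≤ LinearMap.ker (p i) :=
    iSup₂_le fun j hj y hy => h2 i j y hj hy
  rw [← h1 i x hx]
  exact hle hx'

variable {k : Type u} [Field k] {A : Type u} [Ring A] [Algebra k A]

/-- A `ℤ`-graded left module over the algebra `A` graded by `𝒜`. -/
structure GrMod (𝒜 : ℤ → Submodule k A) where
  carrier : Type v
  [addCommGroup : AddCommGroup carrier]
  [moduleBase : Module k carrier]
  [module : Module A carrier]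
  [tower : IsScalarTower k A carrier]
  /-- the homogeneous components -/
  deg : ℤ → Submodule k carrier
  isInternal : DirectSum.IsInternal deg
  smul_mem : ∀ {i j : ℤ} {a : A} {m : carrier}, a ∈ 𝒜 i → m ∈ deg j → a • m ∈ deg (i + j)

namespace GrMod

variable {𝒜 : ℤ → Submodule k A}

instance : CoeSort (GrMod.{u, v} 𝒜) (Type v) := ⟨carrier⟩

attribute [instance] addCommGroup moduleBase module tower

/-- Homomorphisms of graded modules: `A`-linear maps that preserve degree. -/
@[ext]
structure Hom (M N : GrMod.{u, v} 𝒜) where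
  lin : M →ₗ[A] N
  map_deg : ∀ (i : ℤ) (m : M), m ∈ M.deg i → lin m ∈ N.deg i

/-- The category `Gr A` of graded left modules. -/
instance : Category (GrMod.{u, v} 𝒜) where
  Hom := Hom
  id M := ⟨LinearMap.id, fun _ _ h => h⟩
  comp f g := ⟨g.lin.comp f.lin, fun i _ h => g.map_deg i _ (f.map_deg i _ h)⟩

variable {M N T : GrMod.{u, v} 𝒜}

@[ext]
lemma hom_ext {f g : M ⟶ N} (h : ∀ x, f.lin x = g.lin x) : f = g :=
  Hom.ext (LinearMap.ext h)

@[simp] lemma id_lin : (𝟙 M : M ⟶ M).lin = LinearMap.id := rfl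

@[simp] lemma comp_lin (f : M ⟶ N) (g : N ⟶ T) : (f ≫ g).lin = g.lin.comp f.lin := rfl

instance : Zero (M ⟶ N) := ⟨⟨0, fun i _ _ => (N.deg i).zero_mem⟩⟩
instance : Add (M ⟶ N) :=
  ⟨fun f g => ⟨f.lin + g.lin, fun i m h => (N.deg i).add_mem (f.map_deg i m h) (g.map_deg i m h)⟩⟩
instance : Neg (M ⟶ N) :=
  ⟨fun f => ⟨-f.lin, fun i m h => (N.deg i).neg_mem (f.map_deg i m h)⟩⟩

@[simp] lemma zero_lin : (0 : M ⟶ N).lin = 0 := rfl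
@[simp] lemma add_lin (f g : M ⟶ N) : (f + g).lin = f.lin + g.lin := rfl
@[simp] lemma neg_lin (f : M ⟶ N) : (-f).lin = -f.lin := rfl

instance : AddCommGroup (M ⟶ N) where
  add_assoc f g h := Hom.ext (add_assoc f.lin g.lin h.lin)
  zero_add f := Hom.ext (zero_add f.lin)
  add_zero f := Hom.ext (add_zero f.lin)
  add_comm f g := Hom.ext (add_comm f.lin g.lin)
  neg_add_cancel f := Hom.ext (neg_add_cancel f.lin)
  nsmul := nsmulRec
  zsmul := zsmulRec

instance : Preadditive (GrMod.{u, v} 𝒜) where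
  add_comp := by intros; ext; simp
  comp_add := by intros; ext; simp

/-- The projection of a graded module onto its component of degree `i`. -/
def proj (M : GrMod.{u, v} 𝒜) (i : ℤ) : M →ₗ[k] M :=
  (M.deg i).subtype ∘ₗ DirectSum.component k ℤ (fun i => M.deg i) i ∘ₗ
    (LinearEquiv.ofBijective (DirectSum.coeLinearMap M.deg) M.isInternal).symm.toLinearMap

lemma proj_mem (i : ℤ) (x : M) : M.proj i x ∈ M.deg i := Subtype.prop _

lemma symm_of_mem {i : ℤ} {x : M} (h : x ∈ M.deg i) :
    (LinearEquiv.ofBijective (DirectSum.coeLinearMap M.deg) M.isInternal).symm x =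
      DirectSum.lof k ℤ (fun i => M.deg i) i ⟨x, h⟩ := by
  rw [LinearEquiv.symm_apply_eq]
  exact (DirectSum.coeLinearMap_lof M.deg i ⟨x, h⟩).symm

lemma proj_of_mem {i : ℤ} {x : M} (h : x ∈ M.deg i) : M.proj i x = x := by
  simp only [proj, LinearMap.comp_apply, LinearEquiv.coe_coe, symm_of_mem h]
  simp [DirectSum.component.lof_self]

lemma proj_of_mem_ne {i j : ℤ} (hij : j ≠ i) {x : M} (h : x ∈ M.deg j) : M.proj i x = 0 := by
  simp only [proj, LinearMap.comp_apply, LinearEquiv.coe_coe, symm_of_mem h]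
  rw [DirectSum.component.of, dif_neg hij, map_zero]

lemma mem_iSup (x : M) : x ∈ ⨆ i, M.deg i := by
  rw [((DirectSum.isInternal_submodule_iff_iSupIndep_and_iSup_eq_top _).1 M.isInternal).2]
  trivial

lemma exists_sum (x : M) : ∃ s : Finset ℤ, x = ∑ i ∈ s, M.proj i x := by
  classical
  induction M.mem_iSup x using Submodule.iSup_induction' with
  | mem i x h => exact ⟨{i}, by simp [proj_of_mem h]⟩
  | zero => exact ⟨∅, by simp⟩
  | add x y _ _ hx hy =>
    have key : ∀ (z : M) (s t : Finset ℤ), z = ∑ i ∈ s, M.proj i z → s ⊆ t →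
        z = ∑ i ∈ t, M.proj i z := by
      intro z s t hz hst
      rw [← Finset.sum_subset hst (fun i _ his => ?_)]
      · exact hz
      · rw [hz, map_sum]
        exact Finset.sum_eq_zero fun j hj =>
          proj_of_mem_ne (by rintro rfl; exact his hj) (proj_mem j z)
    obtain ⟨s, hs⟩ := hx
    obtain ⟨t, ht⟩ := hy
    refine ⟨s ∪ t, ?_⟩
    simp only [map_add, Finset.sum_add_distrib]
    rw [← key x s _ hs Finset.subset_union_left, ← key y t _ ht Finset.subset_union_right]

lemma map_proj (f : M ⟶ N) (i : ℤ) (x : M) : f.lin (M.proj i x) = N.proj i (f.lin x) := by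
  induction M.mem_iSup x using Submodule.iSup_induction' with
  | mem j x h =>
    by_cases hij : j = i
    · subst hij
      rw [proj_of_mem h, proj_of_mem (f.map_deg _ _ h)]
    · rw [proj_of_mem_ne hij h, proj_of_mem_ne hij (f.map_deg _ _ h), map_zero]
  | zero => simp
  | add x y _ _ hx hy => simp only [map_add, hx, hy]

lemma mem_deg_of_injective {f : M ⟶ N} (hf : Function.Injective f.lin) {i : ℤ} {x : M}
    (h : f.lin x ∈ N.deg i) : x ∈ M.deg i := by
  have : M.proj i x = x := hf (by rw [map_proj, proj_of_mem h])
  rw [← this]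
  exact proj_mem i x

lemma exists_mem_deg_of_surjective {f : M ⟶ N} (hf : Function.Surjective f.lin) {i : ℤ} {y : N}
    (h : y ∈ N.deg i) : ∃ x ∈ M.deg i, f.lin x = y := by
  obtain ⟨x, rfl⟩ := hf y
  exact ⟨M.proj i x, proj_mem i x, by rw [map_proj, proj_of_mem h]⟩

/-- The kernel of a homomorphism of graded modules. -/
def ker (f : M ⟶ N) : GrMod.{u, v} 𝒜 where
  carrier := LinearMap.ker f.lin
  deg i := (M.deg i).comap ((LinearMap.ker f.lin).subtype.restrictScalars k)
  isInternal := by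
    let p : ℤ → LinearMap.ker f.lin →ₗ[k] LinearMap.ker f.lin := fun i =>
      (M.proj i).restrict (p := (LinearMap.ker f.lin).restrictScalars k)
        (q := (LinearMap.ker f.lin).restrictScalars k) (fun x hx => by
          have hx' : f.lin x = 0 := hx
          change f.lin _ = 0
          rw [map_proj, hx', map_zero])
    have hp : ∀ i x, (p i x : M) = M.proj i x := fun i x => rfl
    refine isInternal_of_proj _ p (fun i x hx => Subtype.ext ?_)
      (fun i j x hij hx => Subtype.ext ?_) (fun x => ?_)
    · rw [hp]; exact proj_of_mem hx
    · rw [hp]; exact proj_of_mem_ne hij hx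
    · obtain ⟨s, hs⟩ := exists_sum (x : M)
      have : x = ∑ i ∈ s, p i x := Subtype.ext (by
        rw [AddSubmonoidClass.coe_finsetSum]; exact hs)
      rw [this]
      exact Submodule.sum_mem _ fun i _ => Submodule.mem_iSup_of_mem i (proj_mem i (x : M))
  smul_mem ha hm := M.smul_mem ha hm

/-- The inclusion of the kernel. -/
def kerι (f : M ⟶ N) : ker f ⟶ M := ⟨(LinearMap.ker f.lin).subtype, fun _ _ h => h⟩

/-- The cokernel of a homomorphism of graded modules. -/
def coker (f : M ⟶ N) : GrMod.{u, v} 𝒜 where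
  carrier := N ⧸ LinearMap.range f.lin
  deg i := (N.deg i).map ((LinearMap.range f.lin).mkQ.restrictScalars k)
  isInternal := by
    let p : ℤ → (N ⧸ LinearMap.range f.lin) →ₗ[k] (N ⧸ LinearMap.range f.lin) := fun i =>
      ((LinearMap.range f.lin).restrictScalars k).mapQ
        ((LinearMap.range f.lin).restrictScalars k) (N.proj i) (by
          rintro _ ⟨x, rfl⟩
          exact ⟨M.proj i x, map_proj f i x⟩)
    have hp : ∀ i x, p i ((LinearMap.range f.lin).mkQ x) =
        (LinearMap.range f.lin).mkQ (N.proj i x) := fun i x => rfl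
    refine isInternal_of_proj _ p ?_ ?_ ?_
    · rintro i _ ⟨x, hx, rfl⟩
      exact (hp i x).trans (by rw [proj_of_mem hx]; rfl)
    · rintro i j _ hij ⟨x, hx, rfl⟩
      exact (hp i x).trans (by rw [proj_of_mem_ne hij hx, map_zero])
    · intro x
      obtain ⟨x, rfl⟩ := (LinearMap.range f.lin).mkQ_surjective x
      obtain ⟨s, hs⟩ := exists_sum x
      rw [hs, map_sum]
      exact Submodule.sum_mem _ fun i _ => Submodule.mem_iSup_of_mem i
        ⟨_, proj_mem i x, rfl⟩
  smul_mem := by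
    rintro i j a _ ha ⟨m, hm, rfl⟩
    exact ⟨a • m, N.smul_mem ha hm, rfl⟩

/-- The projection onto the cokernel. -/
def cokerπ (f : M ⟶ N) : N ⟶ coker f :=
  ⟨(LinearMap.range f.lin).mkQ, fun _ m h => ⟨m, h, rfl⟩⟩

lemma kerι_comp (f : M ⟶ N) : kerι f ≫ f = 0 := hom_ext fun x => x.2

lemma comp_cokerπ (f : M ⟶ N) : f ≫ cokerπ f = 0 :=
  hom_ext fun x => (Submodule.Quotient.mk_eq_zero _).2 ⟨x, rfl⟩

lemma lin_apply_eq_zero {f : M ⟶ N} {g : N ⟶ T} (h : f ≫ g = 0) (x : M) :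
    g.lin (f.lin x) = 0 := by
  have := congrArg (fun q : M ⟶ T => q.lin x) h
  exact this

/-- The kernel has its universal property. -/
def kerIsLimit (f : M ⟶ N) : IsLimit (KernelFork.ofι (kerι f) (kerι_comp f)) :=
  KernelFork.IsLimit.ofι _ _
    (fun g hg => ⟨g.lin.codRestrict _ (lin_apply_eq_zero hg), fun i m h => g.map_deg i m h⟩)
    (fun _ _ => rfl)
    (fun _ _ _ hb => hom_ext fun x => Subtype.ext (congrArg (fun q => Hom.lin q x) hb))

/-- The cokernel has its universal property. -/
def cokerIsColimit (f : M ⟶ N) : IsColimit (CokernelCofork.ofπ (cokerπ f) (comp_cokerπ f)) :=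
  CokernelCofork.IsColimit.ofπ _ _
    (fun g hg => ⟨(LinearMap.range f.lin).liftQ g.lin (by
        rintro _ ⟨x, rfl⟩; exact lin_apply_eq_zero hg x), by
        rintro i _ ⟨m, hm, rfl⟩; exact g.map_deg i m hm⟩)
    (fun _ _ => rfl)
    (fun _ _ _ hb => hom_ext fun x => by
      obtain ⟨x, rfl⟩ := (LinearMap.range f.lin).mkQ_surjective x
      exact congrArg (fun q => Hom.lin q x) hb)

lemma injective_of_mono (f : M ⟶ N) [Mono f] : Function.Injective f.lin := by
  have h : kerι f = 0 := zero_of_comp_mono f (kerι_comp f)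
  rw [← LinearMap.ker_eq_bot, LinearMap.ker_eq_bot']
  intro x hx
  exact congrArg (fun q : ker f ⟶ M => q.lin ⟨x, hx⟩) h

lemma surjective_of_epi (f : M ⟶ N) [Epi f] : Function.Surjective f.lin := by
  have h : cokerπ f = 0 := zero_of_epi_comp f (comp_cokerπ f)
  intro y
  exact (Submodule.Quotient.mk_eq_zero _).1 (congrArg (fun q : N ⟶ coker f => q.lin y) h)

/-- The direct sum of two graded modules. -/
def prod (M N : GrMod.{u, v} 𝒜) : GrMod.{u, v} 𝒜 where
  carrier := M × N
  deg i := (M.deg i).prod (N.deg i)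
  isInternal := by
    refine isInternal_of_proj _ (fun i => (M.proj i).prodMap (N.proj i)) ?_ ?_ ?_
    · rintro i ⟨x, y⟩ ⟨hx, hy⟩
      exact Prod.ext (proj_of_mem hx) (proj_of_mem hy)
    · rintro i j ⟨x, y⟩ hij ⟨hx, hy⟩
      exact Prod.ext (proj_of_mem_ne hij hx) (proj_of_mem_ne hij hy)
    · rintro ⟨x, y⟩
      obtain ⟨s, hs⟩ := exists_sum x
      obtain ⟨t, ht⟩ := exists_sum y
      have : ((x, y) : M × N) = ∑ i ∈ s, ((M.proj i x, 0) : M × N) +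
          ∑ i ∈ t, ((0, N.proj i y) : M × N) := by
        refine Prod.ext ?_ ?_
        · simpa [Prod.fst_sum] using hs
        · simpa [Prod.snd_sum] using ht
      rw [this]
      refine Submodule.add_mem _ (Submodule.sum_mem _ fun i _ => ?_)
        (Submodule.sum_mem _ fun i _ => ?_)
      · exact Submodule.mem_iSup_of_mem i ⟨proj_mem i x, (N.deg i).zero_mem⟩
      · exact Submodule.mem_iSup_of_mem i ⟨(M.deg i).zero_mem, proj_mem i y⟩
  smul_mem ha hm := ⟨M.smul_mem ha hm.1, N.smul_mem ha hm.2⟩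

instance : HasZeroObject (GrMod.{u, v} 𝒜) := by
  let Z : GrMod.{u, v} 𝒜 :=
    { carrier := PUnit
      deg := fun _ => ⊥
      isInternal := isInternal_of_proj _ (fun _ => 0) (fun _ _ _ => rfl) (fun _ _ _ _ _ => rfl)
        (fun x => by rw [Subsingleton.elim x 0]; exact Submodule.zero_mem _)
      smul_mem := fun _ _ => Subsingleton.elim _ _ }
  refine ⟨Z, (IsZero.iff_id_eq_zero Z).2 (hom_ext fun x => ?_)⟩
  exact Subsingleton.elim (α := PUnit) _ _

instance : HasFiniteProducts (GrMod.{u, v} 𝒜) := by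
  have h (M N : GrMod.{u, v} 𝒜) : HasLimit (pair M N) := by
    let p : prod M N ⟶ M := ⟨LinearMap.fst A M N, fun _ _ h => h.1⟩
    let q : prod M N ⟶ N := ⟨LinearMap.snd A M N, fun _ _ h => h.2⟩
    refine ⟨⟨BinaryFan.mk p q, BinaryFan.IsLimit.mk _
      (fun f g => ⟨f.lin.prod g.lin, fun i m h => ⟨f.map_deg i m h, g.map_deg i m h⟩⟩)
      (fun _ _ => rfl) (fun _ _ => rfl) ?_⟩⟩
    rintro T _ _ m rfl rfl
    rfl
  have := hasBinaryProducts_of_hasLimit_pair (GrMod.{u, v} 𝒜)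
  exact hasFiniteProducts_of_has_binary_and_terminal

instance : HasKernels (GrMod.{u, v} 𝒜) := ⟨fun f => ⟨⟨_, kerIsLimit f⟩⟩⟩

instance : HasCokernels (GrMod.{u, v} 𝒜) := ⟨fun f => ⟨⟨_, cokerIsColimit f⟩⟩⟩

/-- Every monomorphism of graded modules is the kernel of its cokernel. -/
lemma nonempty_normalMono (f : M ⟶ N) [Mono f] : Nonempty (NormalMono f) := ⟨{
    Z := coker f
    g := cokerπ f
    w := comp_cokerπ f
    isLimit := KernelFork.IsLimit.ofι _ _
      (fun g hg => ⟨(LinearEquiv.ofInjective f.lin (injective_of_mono f)).symm.toLinearMap ∘ₗ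
          g.lin.codRestrict (LinearMap.range f.lin) (fun x =>
            (Submodule.Quotient.mk_eq_zero _).1 (lin_apply_eq_zero hg x)), fun i m h => by
          refine mem_deg_of_injective (injective_of_mono f) ?_
          simpa using g.map_deg i m h⟩)
      (fun g hg => hom_ext fun x => by simp)
      (fun g hg b hb => by
        rw [← cancel_mono f, hb]
        exact hom_ext fun x => by simp) }⟩

/-- Every epimorphism of graded modules is the cokernel of its kernel. -/
lemma nonempty_normalEpi (f : M ⟶ N) [Epi f] : Nonempty (NormalEpi f) := by
  have key : ∀ {T : GrMod.{u, v} 𝒜} (g : M ⟶ T), kerι f ≫ g = 0 → ∃ d : N ⟶ T, f ≫ d = g := by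
    intro T g hg
    let d : N →ₗ[A] T := (LinearMap.ker f.lin).liftQ g.lin (fun x hx =>
        lin_apply_eq_zero hg (⟨x, hx⟩ : LinearMap.ker f.lin)) ∘ₗ
      (f.lin.quotKerEquivOfSurjective (surjective_of_epi f)).symm.toLinearMap
    have hd : ∀ x, d (f.lin x) = g.lin x := fun x => by
      have : (f.lin.quotKerEquivOfSurjective (surjective_of_epi f)).symm (f.lin x) =
          Submodule.Quotient.mk x := by
        rw [LinearEquiv.symm_apply_eq]; rfl
      simp only [d, LinearMap.comp_apply, LinearEquiv.coe_coe, this]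
      exact Submodule.liftQ_apply _ _ _
    refine ⟨⟨d, fun i m h => ?_⟩, hom_ext hd⟩
    obtain ⟨x, hx, rfl⟩ := exists_mem_deg_of_surjective (surjective_of_epi f) h
    rw [hd]
    exact g.map_deg i x hx
  exact ⟨{
    W := ker f
    g := kerι f
    w := kerι_comp f
    isColimit := CokernelCofork.IsColimit.ofπ _ _
      (fun g hg => (key g hg).choose) (fun g hg => (key g hg).choose_spec)
      (fun g hg b hb => by rw [← cancel_epi f, hb, (key g hg).choose_spec]) }⟩

instance : Abelian (GrMod.{u, v} 𝒜) where
  normalMonoOfMono f _ := nonempty_normalMono f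
  normalEpiOfEpi f _ := nonempty_normalEpi f

lemma proj_smul {i j : ℤ} {a : A} (ha : a ∈ 𝒜 j) (x : M) :
    M.proj (j + i) (a • x) = a • M.proj i x := by
  induction M.mem_iSup x using Submodule.iSup_induction' with
  | mem l x h =>
    by_cases hl : l = i
    · subst hl
      rw [proj_of_mem h, proj_of_mem (M.smul_mem ha h)]
    · rw [proj_of_mem_ne hl h, proj_of_mem_ne (by simpa using hl) (M.smul_mem ha h), smul_zero]
  | zero => simp
  | add x y _ _ hx hy => simp only [map_add, smul_add, hx, hy]

/-- The graded modules that are unions of their finite-dimensional graded submodules. -/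
def fdim (𝒜 : ℤ → Submodule k A) : ObjectProperty (GrMod.{u, v} 𝒜) := fun M =>
  ∀ m : M, ∃ L : Submodule A M,
    L.restrictScalars k = ⨆ i, L.restrictScalars k ⊓ M.deg i ∧
      FiniteDimensional k (L.restrictScalars k) ∧ m ∈ L

end GrMod

end Graded

noncomputable section QGr

variable {k : Type u} [Field k] {r : ℕ}

namespace GrMod

lemma word_smul_proj {M : GrMod.{u, v} (grading k r)} {m : M} {w : List (Fin 2)}
    (h : word k r w • m = 0) (i : ℤ) : word k r w • M.proj i m = 0 := by
  rw [← proj_smul (word_mem k r w), h, map_zero]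

/-- A graded `B`-module is a union of finite-dimensional graded submodules if and only if every
element is annihilated by all long words. -/
lemma fdim_iff (M : GrMod.{u, v} (grading k r)) :
    fdim (grading k r) M ↔
      ∀ m : M, ∃ n : ℕ, ∀ w : List (Fin 2), n ≤ w.length → word k r w • m = 0 := by
  classical
  constructor
  · intro h m
    obtain ⟨L, -, hfin, hm⟩ := h m
    obtain ⟨s, hs⟩ := (Module.Finite.iff_fg.1 hfin : (L.restrictScalars k).FG)
    choose t ht using fun x : M => exists_sum x
    let S : Finset ℤ := s.biUnion t
    have hS : ∀ x ∈ L, ∀ i, i ∉ S → M.proj i x = 0 := by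
      intro x hx i hi
      have hx' : x ∈ Submodule.span k (s : Set M) := by rw [hs]; exact hx
      refine (Submodule.span_le (p := LinearMap.ker (M.proj i))).2 ?_ hx'
      intro y hy
      change M.proj i y = 0
      rw [ht y, map_sum]
      refine Finset.sum_eq_zero fun j hj => proj_of_mem_ne ?_ (proj_mem j y)
      rintro rfl
      exact hi (Finset.mem_biUnion.2 ⟨y, hy, hj⟩)
    obtain ⟨D, hD⟩ := S.bddAbove
    obtain ⟨E, hE⟩ := S.bddBelow
    refine ⟨(D - E + 1).toNat, fun w hw => ?_⟩
    rw [ht m, Finset.smul_sum]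
    refine Finset.sum_eq_zero fun i _ => ?_
    by_cases hi : i ∈ S
    · rw [← proj_smul (word_mem k r w)]
      refine hS _ (L.smul_mem _ hm) _ fun h' => ?_
      have h1 := hD h'
      have h2 := hE hi
      omega
    · rw [hS m hm i hi, smul_zero]
  · intro h m
    obtain ⟨n, hn⟩ := h m
    obtain ⟨s, hs⟩ := exists_sum m
    let T : Set M := Set.image2 (fun w i => word k r w • M.proj i m) {w | w.length < n} s
    have hT : T.Finite := (List.finite_length_lt (Fin 2) n).image2 _ s.finite_toSet
    have hword : ∀ (w : List (Fin 2)) (x : M), x ∈ Submodule.span k T →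
        word k r w • x ∈ Submodule.span k T := by
      intro w x hx
      induction hx using Submodule.span_induction with
      | mem x hx =>
        obtain ⟨w', hw', i, hi, rfl⟩ := hx
        dsimp only
        rw [smul_smul, ← word_append]
        by_cases hl : (w ++ w').length < n
        · exact Submodule.subset_span ⟨_, hl, i, hi, rfl⟩
        · rw [word_smul_proj (hn _ (not_lt.1 hl))]
          exact Submodule.zero_mem _
      | zero => rw [smul_zero]; exact Submodule.zero_mem _
      | add x y _ _ hx hy => rw [smul_add]; exact Submodule.add_mem _ hx hy
      | smul c x _ hx => rw [smul_comm]; exact Submodule.smul_mem _ c hx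
    let L : Submodule (B k r) M :=
      { (Submodule.span k T).toAddSubmonoid with
        smul_mem' := by
          intro b x hx
          change b • x ∈ Submodule.span k T
          replace hx : x ∈ Submodule.span k T := hx
          induction mem_span_words k r b using Submodule.span_induction with
          | mem b hb =>
            obtain ⟨w, rfl⟩ := hb
            exact hword w x hx
          | zero => rw [zero_smul]; exact Submodule.zero_mem _
          | add b c _ _ hb hc => rw [add_smul]; exact Submodule.add_mem _ hb hc
          | smul c b _ hb => rw [smul_assoc]; exact Submodule.smul_mem _ c hb }
    have hL : L.restrictScalars k = Submodule.span k T := rfl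
    refine ⟨L, ?_, ?_, ?_⟩
    · rw [hL]
      refine le_antisymm (Submodule.span_le.2 ?_) (iSup_le fun i => inf_le_left)
      rintro _ ⟨w, hw, i, hi, rfl⟩
      exact Submodule.mem_iSup_of_mem (w.length + i)
        ⟨Submodule.subset_span ⟨w, hw, i, hi, rfl⟩, M.smul_mem (word_mem k r w) (proj_mem i m)⟩
    · rw [hL]
      exact FiniteDimensional.span_of_finite k hT
    · change m ∈ Submodule.span k T
      rw [hs]
      refine Submodule.sum_mem _ fun i hi => ?_
      have h1 : word k r [] • M.proj i m = M.proj i m := by simp [word]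
      by_cases h0 : 0 < n
      · exact Submodule.subset_span ⟨[], h0, i, hi, h1⟩
      · rw [← h1, word_smul_proj (hn [] (by simpa using h0))]
        exact Submodule.zero_mem _

instance : (fdim.{u, v} (grading k r)).IsSerreClass where
  exists_zero := by
    obtain ⟨Z, hZ⟩ := HasZeroObject.zero (C := GrMod.{u, v} (grading k r))
    refine ⟨Z, hZ, (fdim_iff _).2 fun m => ⟨0, fun w _ => ?_⟩⟩
    have h : m = 0 := congrArg (fun q : Z ⟶ Z => q.lin m) ((IsZero.iff_id_eq_zero Z).1 hZ)
    rw [h, smul_zero]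
  prop_of_mono {X Y} f _ hY := by
    rw [fdim_iff] at hY ⊢
    intro m
    obtain ⟨n, hn⟩ := hY (f.lin m)
    exact ⟨n, fun w hw => injective_of_mono f (by rw [map_smul, hn w hw, map_zero])⟩
  prop_of_epi {X Y} f _ hX := by
    rw [fdim_iff] at hX ⊢
    intro m
    obtain ⟨m, rfl⟩ := surjective_of_epi f m
    obtain ⟨n, hn⟩ := hX m
    exact ⟨n, fun w hw => by rw [← map_smul, hn w hw, map_zero]⟩
  prop_X₂_of_shortExact {S} hS h₁ h₃ := by
    rw [fdim_iff] at h₁ h₃ ⊢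
    have := hS.mono_f
    have hex : ∀ x : S.X₂, S.g.lin x = 0 → ∃ z : S.X₁, S.f.lin z = x := by
      intro x hx
      have h := hS.fIsKernel.fac (KernelFork.ofι (kerι S.g) (kerι_comp S.g)) WalkingParallelPair.zero
      exact ⟨_, congrArg (fun q : ker S.g ⟶ S.X₂ => q.lin ⟨x, hx⟩) h⟩
    intro m
    obtain ⟨n, hn⟩ := h₃ (S.g.lin m)
    have hz : ∀ w : List (Fin 2), ∃ n', w.length = n → ∀ w' : List (Fin 2), n' ≤ w'.length →
        word k r (w' ++ w) • m = 0 := by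
      intro w
      by_cases hw : w.length = n
      · obtain ⟨z, hz⟩ := hex (word k r w • m) (by rw [map_smul, hn w hw.ge])
        obtain ⟨n', hn'⟩ := h₁ z
        exact ⟨n', fun _ w' hw' => by
          rw [word_append, mul_smul, ← hz, ← map_smul, hn' w' hw', map_zero]⟩
      · exact ⟨0, fun h => absurd h hw⟩
    choose N hN using hz
    have hfin : {w : List (Fin 2) | w.length = n}.Finite := List.finite_length_eq (Fin 2) n
    obtain ⟨D, hD⟩ := (hfin.image N).bddAbove
    refine ⟨n + D, fun w hw => ?_⟩
    have hd : (w.drop (w.length - n)).length = n := by rw [List.length_drop]; omega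
    have := hN (w.drop (w.length - n)) hd (w.take (w.length - n)) (by
      refine (hD ⟨_, hd, rfl⟩).trans ?_
      rw [List.length_take]; omega)
    rwa [List.take_append_drop] at this

end GrMod

variable (k r) in
/-- The category `QGr B` of quasi-coherent sheaves on `Proj_nc B`: the quotient of the category of
graded left `B`-modules by the Serre subcategory of modules that are unions of their
finite-dimensional submodules, i.e. the localization at the homomorphisms whose kernel and cokernel
belong to that subcategory. -/
abbrev QGr : Type (u + 1) :=
  (GrMod.fdim.{u, u} (grading k r)).isoModSerre.Localization

end QGr

/-- Closed subspaces of the non-commutative space whose category of quasi-coherent sheaves is `C`: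
the full subcategories that are closed under subobjects and quotients and whose inclusion functor
has both a right adjoint and a left adjoint. -/
structure IsClosedSubspace {C : Type*} [Category* C] (P : ObjectProperty C) : Prop where
  sub : P.IsClosedUnderSubobjects
  quot : P.IsClosedUnderQuotients
  hasRightAdjoint : P.ι.IsLeftAdjoint
  hasLeftAdjoint : P.ι.IsRightAdjoint

end NCProj

namespace NCProj

noncomputable section QGr

variable {k : Type u} [Field k] {r : ℕ}

/-! Let `F` be the left adjoint of the inclusion of `P`, with unit `η n` on the sheaf of the free
module generated in degree `n`. Everything depends on whether all these units are monomorphisms.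

If they are, closure under subobjects puts every free module in `P`. Free modules generate
(`eq_zero_of_free`), so the counit of the right adjoint is an epimorphism onto any object, and
closure under quotients gives everything.

If `η n` is not mono, it kills the image of a nonzero homogeneous `b` of degree `m`
(`exists_desc_comp_eq_zero`). For every `l > m`, the free module generated in degree `l` is, in
`QGr`, a retract of the one generated in degree `n`, by a section that factors through `b`
(`exists_isIso_comp_desc_comp`). A morphism from it to an object of `P` therefore extends to the
free module in degree `n`, where it factors through `η n`; restricted along `b` it vanishes. Since
free modules in large degrees already generate, objects of `P` are zero.

The retraction extracts the coefficient of one word `w` of `b`. It is a map to an enlargement `E` of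
a free module with torsion cokernel, in which some `e` is sent to the generator by `x ^ j * w` and
to `0` by all other words of that length (`exists_coefficient`). `E` is built by adjoining one
vector per letter; the relation `y ^ (r + 1) = 0` survives because the word begins with `x` and
contains no `y ^ (r + 1)`. -/

lemma word_cons (a : Fin 2) (w : List (Fin 2)) : word k r (a :: w) = gen k r a * word k r w := by
  simp [word]

namespace GrMod

/-! ### Torsion elements and morphisms invertible modulo torsion -/

/-- An element of a graded `B`-module is torsion if all long words annihilate it. -/
def IsTorsion (M : GrMod.{u, v} (grading k r)) (m : M) : Prop :=
  ∃ n : ℕ, ∀ w : List (Fin 2), n ≤ w.length → word k r w • m = 0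

lemma IsTorsion.sum {M : GrMod.{u, v} (grading k r)} {ι : Type*} (s : Finset ι) (f : ι → M)
    (h : ∀ i ∈ s, M.IsTorsion (f i)) : M.IsTorsion (∑ i ∈ s, f i) := by
  classical
  induction s using Finset.induction_on with
  | empty => exact ⟨0, fun w _ => by simp⟩
  | insert a s ha ih =>
    obtain ⟨n, hn⟩ := h a (Finset.mem_insert_self a s)
    obtain ⟨p, hp⟩ := ih fun i hi => h i (Finset.mem_insert_of_mem hi)
    refine ⟨max n p, fun w hw => ?_⟩
    rw [Finset.sum_insert ha, smul_add, hn w ((le_max_left _ _).trans hw),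
      hp w ((le_max_right _ _).trans hw), add_zero]

/-- An element is torsion if its multiples by all words of some fixed length are. -/
lemma IsTorsion.of_words {M : GrMod.{u, v} (grading k r)} {m : M} (n : ℕ)
    (h : ∀ w : List (Fin 2), w.length = n → M.IsTorsion (word k r w • m)) : M.IsTorsion m := by
  have h' : ∀ w : List (Fin 2), ∃ p, w.length = n → ∀ w' : List (Fin 2), p ≤ w'.length →
      word k r w' • word k r w • m = 0 := fun w => by
    by_cases hw : w.length = n
    · obtain ⟨p, hp⟩ := h w hw
      exact ⟨p, fun _ => hp⟩
    · exact ⟨0, fun h => absurd h hw⟩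
  choose N hN using h'
  obtain ⟨D, hD⟩ := ((List.finite_length_eq (Fin 2) n).image N).bddAbove
  -- There are finitely many words of length `n`, so one bound `D` serves them all. The last `n`
  -- letters of `w` act first; at least `D` letters remain to kill the result.
  refine ⟨n + D, fun w hw => ?_⟩
  have hd : (w.drop (w.length - n)).length = n := by rw [List.length_drop]; omega
  have := hN (w.drop (w.length - n)) hd (w.take (w.length - n)) (by
    refine (hD ⟨_, hd, rfl⟩).trans ?_
    rw [List.length_take]; omega)
  rwa [smul_smul, ← word_append, List.take_append_drop] at this

/-- A morphism dies in the Serre quotient exactly when its image lies in the Serre subcategory; this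
makes that condition checkable on elements. -/
lemma fdim_image_iff {M N : GrMod.{u, v} (grading k r)} (f : M ⟶ N) :
    fdim (grading k r) (Abelian.image f) ↔ ∀ m : M, N.IsTorsion (f.lin m) := by
  have hf : ∀ m, (Abelian.image.ι f).lin ((Abelian.factorThruImage f).lin m) = f.lin m :=
    fun m => congrArg (fun q : M ⟶ N => q.lin m) (Abelian.image.fac f)
  rw [fdim_iff]
  constructor
  · intro h m
    obtain ⟨n, hn⟩ := h ((Abelian.factorThruImage f).lin m)
    exact ⟨n, fun w hw => by rw [← hf, ← map_smul, hn w hw, map_zero]⟩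
  · intro h y
    obtain ⟨m, rfl⟩ := surjective_of_epi (Abelian.factorThruImage f) y
    obtain ⟨n, hn⟩ := h m
    exact ⟨n, fun w hw => injective_of_mono (Abelian.image.ι f) (by
      rw [map_smul, hf, hn w hw, map_zero])⟩

lemma mono_of_injective {A : Type u} [Ring A] [Algebra k A] {𝒜 : ℤ → Submodule k A}
    {M N : GrMod.{u, v} 𝒜} (f : M ⟶ N) (hf : Function.Injective f.lin) : Mono f :=
  ⟨fun _ _ hgh => hom_ext fun x => hf (congrArg (fun q => Hom.lin q x) hgh)⟩

lemma isoModSerre_of_injective {M N : GrMod.{u, v} (grading k r)} (f : M ⟶ N)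
    (hf : Function.Injective f.lin)
    (h : ∀ y : N, ∃ n : ℕ, ∀ w : List (Fin 2), n ≤ w.length → ∃ x, f.lin x = word k r w • y) :
    (fdim.{u, v} (grading k r)).isoModSerre f := by
  have := mono_of_injective f hf
  refine ObjectProperty.isoModSerre_of_mono _ f ?_
  rw [ObjectProperty.epiModSerre_iff, fdim_iff]
  intro y
  obtain ⟨y, rfl⟩ := surjective_of_epi (cokernel.π f) y
  obtain ⟨n, hn⟩ := h y
  refine ⟨n, fun w hw => ?_⟩
  obtain ⟨x, hx⟩ := hn w hw
  rw [← map_smul, ← hx, lin_apply_eq_zero (cokernel.condition f)]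

/-! ### Free graded modules of rank one -/

variable (k r) in
/-- The free graded `B`-module of rank one whose generator has degree `n`. -/
def free (n : ℤ) : GrMod.{u, u} (grading k r) where
  carrier := B k r
  deg i := grading k r (i - n)
  isInternal := by
    classical
    refine isInternal_of_proj _ (fun i => GradedAlgebra.proj (grading k r) (i - n)) ?_ ?_ ?_
    · intro i x hx
      exact DirectSum.decompose_of_mem_same _ hx
    · intro i j x hij hx
      exact DirectSum.decompose_of_mem_ne _ hx (by simpa using hij)
    · intro x
      rw [← DirectSum.sum_support_decompose (grading k r) x]
      refine Submodule.sum_mem _ fun i _ => Submodule.mem_iSup_of_mem (i + n) ?_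
      rw [add_sub_cancel_right]
      exact SetLike.coe_mem _
  smul_mem ha hm := by
    rw [add_sub_assoc]
    exact SetLike.mul_mem_graded ha hm

/-- The homomorphism from a free module of rank one determined by a homogeneous element. -/
def desc {n : ℤ} {M : GrMod.{u, u} (grading k r)} (m : M) (hm : m ∈ M.deg n) : free k r n ⟶ M where
  lin := LinearMap.toSpanSingleton (B k r) M m
  map_deg i a ha := by
    have := M.smul_mem ha hm
    rwa [sub_add_cancel] at this

lemma free_hom_ext {n : ℤ} {M : GrMod.{u, u} (grading k r)} {f g : free k r n ⟶ M}
    (h : f.lin (1 : B k r) = g.lin (1 : B k r)) : f = g := by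
  refine hom_ext fun (x : B k r) => ?_
  have e : ∀ f : free k r n ⟶ M, f.lin x = x • f.lin (1 : B k r) := fun f => by
    exact (congrArg f.lin (mul_one x).symm).trans (f.lin.map_smul x (1 : B k r))
  rw [e, e, h]

lemma desc_comp {n : ℤ} {M N : GrMod.{u, u} (grading k r)} (m : M) (hm : m ∈ M.deg n)
    (f : M ⟶ N) : desc m hm ≫ f = desc (f.lin m) (f.map_deg n m hm) :=
  hom_ext fun x => f.lin.map_smul (show B k r from x) m

/-! ### Adjoining one vector to a graded module -/

/-- To check compatibility of the action with the grading, it suffices to consider generators. -/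
lemma smul_mem_of_gen {M : Type*} [AddCommGroup M] [Module k M] [Module (B k r) M]
    [IsScalarTower k (B k r) M] (D : ℤ → Submodule k M)
    (h : ∀ (c : Fin 2) (j : ℤ) (m : M), m ∈ D j → gen k r c • m ∈ D (1 + j)) {i j : ℤ} {a : B k r}
    {m : M} (ha : a ∈ grading k r i) (hm : m ∈ D j) : a • m ∈ D (i + j) := by
  rw [grading] at ha
  induction ha using Submodule.span_induction with
  | mem a ha =>
    obtain ⟨w, rfl, rfl⟩ := ha
    induction w with
    | nil => simpa [word] using hm
    | cons c w ih =>
      rw [word_cons, mul_smul]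
      have := h c _ _ ih
      rwa [← add_assoc, add_comm (1 : ℤ), ← Nat.cast_succ] at this
  | zero => rw [zero_smul]; exact Submodule.zero_mem _
  | add a b _ _ ha hb => rw [add_smul]; exact Submodule.add_mem _ ha hb
  | smul c a _ ha => rw [smul_assoc]; exact Submodule.smul_mem _ c ha

section Extend

variable (E : GrMod.{u, u} (grading k r)) (e : E) (a : Fin 2)

/-- The action of the generator `c` on the extension of `E` by one vector that `a` maps to `e` and
the other generator to `0`. -/
def extendGen (c : Fin 2) : E × k →ₗ[k] E × k :=
  ((Algebra.lsmul k k E (gen k r c)).coprod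
    (if c = a then LinearMap.toSpanSingleton k E e else 0)).prod 0

lemma extendGen_apply (c : Fin 2) (v : E) (t : k) :
    extendGen E e a c (v, t) = (gen k r c • v + if c = a then t • e else 0, 0) := by
  unfold extendGen
  split_ifs <;> simp

/-- The first application of `y` clears the last coordinate, so later ones only act on `E`. At `n =
r` this shows that the sole obstruction to the relation is `y ^ r • e`, and only when `a` is `y`;
hence the hypothesis `he` below. -/
lemma extendGen_pow (n : ℕ) (v : E) (t : k) :
    (extendGen E e a 1 ^ (n + 1)) (v, t) =
      (gen k r 1 ^ (n + 1) • v + if 1 = a then t • gen k r 1 ^ n • e else 0, 0) := by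
  induction n with
  | zero => simp [extendGen_apply]
  | succ n ih =>
    rw [pow_succ', Module.End.mul_apply, ih, extendGen_apply]
    split_ifs <;> simp [smul_add, smul_smul, pow_succ', smul_comm t]

variable (he : a = 1 → gen k r 1 ^ r • e = 0)

/-- The action of `B` on the extension of `E` by one vector. -/
def extendAction : B k r →ₐ[k] Module.End k (E × k) :=
  RingQuot.liftAlgHom k ⟨FreeAlgebra.lift k (extendGen E e a), by
    rintro _ _ ⟨rfl, rfl⟩
    rw [map_pow, FreeAlgebra.lift_ι_apply, map_zero]
    refine LinearMap.ext fun ⟨v, t⟩ => ?_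
    have h0 : gen k r 1 ^ (r + 1) = 0 := by
      rw [gen, ← map_pow, RingQuot.mkAlgHom_rel (s := Rel k r) k ⟨rfl, rfl⟩, map_zero]
    rw [extendGen_pow, h0]
    split_ifs with h
    · simp [he h.symm]
    · simp⟩

lemma extendAction_gen (c : Fin 2) : extendAction E e a he (gen k r c) = extendGen E e a c := by
  rw [gen, extendAction, RingQuot.liftAlgHom_mkAlgHom_apply, FreeAlgebra.lift_ι_apply]

/-- The extension of the graded module `E` by one homogeneous vector `e'` of degree `n` such that
`a` maps `e'` to `e` and the other generator maps it to `0`. -/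
def extend (n : ℤ) (hn : e ∈ E.deg (1 + n)) : GrMod.{u, u} (grading k r) :=
  letI : Module (B k r) (E × k) := Module.compHom (E × k) (extendAction E e a he).toRingHom
  haveI : IsScalarTower k (B k r) (E × k) := ⟨fun c b v => by
    change extendAction E e a he (c • b) v = c • extendAction E e a he b v
    rw [map_smul]; rfl⟩
  { carrier := E × k
    module := Module.compHom (E × k) (extendAction E e a he).toRingHom
    deg := fun i => (E.deg i).prod (if i = n then ⊤ else ⊥)
    isInternal := by
      refine isInternal_of_proj _
        (fun i => (E.proj i).prodMap (if i = n then LinearMap.id else 0)) ?_ ?_ ?_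
      · rintro i ⟨x, t⟩ ⟨hx, ht⟩
        refine Prod.ext (proj_of_mem hx) ?_
        by_cases h : i = n <;> simp_all
      · rintro i j ⟨x, t⟩ hij ⟨hx, ht⟩
        refine Prod.ext (proj_of_mem_ne hij hx) ?_
        by_cases h : i = n <;> simp_all
      · rintro ⟨x, t⟩
        obtain ⟨s, hs⟩ := exists_sum x
        have : ((x, t) : E × k) = ∑ i ∈ s, ((E.proj i x, 0) : E × k) + (0, t) := by
          refine Prod.ext ?_ ?_
          · simpa [Prod.fst_sum] using hs
          · simp [Prod.snd_sum]
        rw [this]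
        refine Submodule.add_mem _ (Submodule.sum_mem _ fun i _ => ?_) ?_
        · exact Submodule.mem_iSup_of_mem i ⟨proj_mem i x, Submodule.zero_mem _⟩
        · exact Submodule.mem_iSup_of_mem n ⟨(E.deg n).zero_mem, by simp⟩
    smul_mem := fun ha hm => by
      let D : ℤ → Submodule k (E × k) := fun i => (E.deg i).prod (if i = n then ⊤ else ⊥)
      refine smul_mem_of_gen D ?_ ha hm
      rintro c j ⟨v, t⟩ ⟨hv, ht⟩
      change extendAction E e a he (gen k r c) (v, t) ∈ _
      rw [extendAction_gen, extendGen_apply]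
      refine ⟨Submodule.add_mem _ (E.smul_mem (gen_mem k r c) hv) ?_, Submodule.zero_mem _⟩
      split_ifs
      · by_cases h : j = n
        · subst h; exact Submodule.smul_mem _ _ hn
        · have ht' : t = 0 := by simpa [h] using ht
          rw [ht', zero_smul]; exact Submodule.zero_mem _
      · exact Submodule.zero_mem _ }

variable (n : ℤ) (hn : e ∈ E.deg (1 + n))

/-- The elements of the extension. -/
def extendMk (v : E) (t : k) : extend E e a he n hn := (v, t)

lemma extend_gen_smul (c : Fin 2) (v : E) (t : k) :
    gen k r c • extendMk E e a he n hn v t =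
      extendMk E e a he n hn (gen k r c • v + if c = a then t • e else 0) 0 := by
  change extendAction E e a he (gen k r c) (v, t) = _
  rw [extendAction_gen, extendGen_apply]
  rfl

lemma extend_word_smul (w : List (Fin 2)) (v : E) :
    word k r w • extendMk E e a he n hn v 0 = extendMk E e a he n hn (word k r w • v) 0 := by
  induction w with
  | nil =>
    have h : word k r [] = 1 := rfl
    rw [h, one_smul, one_smul]
  | cons c w ih =>
    rw [word_cons, mul_smul, ih, extend_gen_smul, mul_smul]
    simp

lemma extend_smul (b : B k r) (v : E) :
    b • extendMk E e a he n hn v 0 = extendMk E e a he n hn (b • v) 0 := by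
  induction mem_span_words k r b using Submodule.span_induction with
  | mem b hb =>
    obtain ⟨w, rfl⟩ := hb
    exact extend_word_smul E e a he n hn w v
  | zero => rw [zero_smul, zero_smul]; rfl
  | add b c _ _ hb hc =>
    rw [add_smul, add_smul, hb, hc]
    exact Prod.ext rfl (add_zero (0 : k))
  | smul c b _ hb =>
    rw [smul_assoc, smul_assoc, hb]
    exact Prod.ext rfl (mul_zero c)

/-- The inclusion into the extension. -/
def extendι : E ⟶ extend E e a he n hn where
  lin :=
    { toFun := fun v => extendMk E e a he n hn v 0
      map_add' := fun _ _ => Prod.ext rfl (add_zero (0 : k)).symm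
      map_smul' := fun b v => (extend_smul E e a he n hn b v).symm }
  map_deg _ _ hv := ⟨hv, Submodule.zero_mem _⟩

end Extend

/-- A graded module can be enlarged, up to torsion, by a vector that one of the generators maps to a
given vector and the other generator to `0`. -/
lemma exists_extend (E : GrMod.{u, u} (grading k r)) (e : E) (a : Fin 2)
    (he : a = 1 → gen k r 1 ^ r • e = 0) (n : ℤ) (hn : e ∈ E.deg (1 + n)) :
    ∃ (E' : GrMod.{u, u} (grading k r)) (j : E ⟶ E') (e' : E'),
      (fdim.{u, u} (grading k r)).isoModSerre j ∧ e' ∈ E'.deg n ∧ gen k r a • e' = j.lin e ∧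
        ∀ c, c ≠ a → gen k r c • e' = 0 := by
  refine ⟨extend E e a he n hn, extendι E e a he n hn, extendMk E e a he n hn 0 1,
    isoModSerre_of_injective _ (fun v w hvw => congrArg Prod.fst hvw) ?_,
    ⟨Submodule.zero_mem _, by simp⟩, ?_, ?_⟩
  · intro y
    obtain ⟨v, t, rfl⟩ : ∃ v t, extendMk E e a he n hn v t = y := ⟨y.1, y.2, rfl⟩
    -- Both generators map the new vector into `E`, so the first letter to act already suffices.
    refine ⟨1, fun w hw => ?_⟩
    obtain rfl | ⟨w, c, rfl⟩ := List.eq_nil_or_concat w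
    · simp at hw
    · refine ⟨word k r w • (gen k r c • v + if c = a then t • e else 0), ?_⟩
      have h1 : word k r (w.concat c) = word k r w * gen k r c := by simp [word]
      rw [h1, mul_smul, extend_gen_smul, extend_word_smul]
      rfl
  · rw [extend_gen_smul, if_pos rfl, smul_zero, zero_add, one_smul]
    rfl
  · intro c hc
    rw [extend_gen_smul, if_neg hc, smul_zero, zero_add]
    rfl

/-! ### Extracting the coefficient of a word -/

/-- For a word `w` that is empty or starts with `x` and that does not contain `y ^ (r + 1)`, there
is, up to torsion, an extension of the free module of rank one with an element `e` that `w` maps to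
the generator and the other words of the same length to `0`. -/
lemma exists_coefficient (n : ℤ) (w : List (Fin 2)) (hw : ∀ v, w ≠ 1 :: v)
    (hy : ¬ List.replicate (r + 1) 1 <:+: w) :
    ∃ (E : GrMod.{u, u} (grading k r)) (j : free k r n ⟶ E) (e : E),
      (fdim.{u, u} (grading k r)).isoModSerre j ∧ e ∈ E.deg (n - w.length) ∧
        word k r w • e = j.lin (1 : B k r) ∧
        ∀ v, ¬ v <:+ w → ¬ w <:+ v → word k r v • e = 0 := by
  induction w using List.reverseRecOn with
  | nil =>
    refine ⟨free k r n, 𝟙 _, (1 : B k r), ObjectProperty.isoModSerre_of_isIso _ _, ?_, ?_, ?_⟩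
    · change (1 : B k r) ∈ grading k r _
      simpa [word] using word_mem k r []
    · exact one_smul _ _
    · intro v _ h
      exact absurd v.nil_suffix h
  -- The induction appends letters on the right because the rightmost letter acts first: `a` sends
  -- the new vector to the old `e`, after which `w` takes over.
  | append_singleton w a ih =>
    have hw' : ∀ v, w ≠ 1 :: v := by
      rintro v rfl
      exact hw (v ++ [a]) rfl
    obtain ⟨E, j, e, hj, he, h1, h2⟩ :=
      ih hw' fun h => hy (h.trans (List.prefix_append w [a]).isInfix)
    have hpow : gen k r 1 ^ r = word k r (List.replicate r 1) := by simp [word]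
    -- For `a = y` the extension needs `y ^ r • e = 0`, which is the inductive vanishing at the word
    -- `y ^ r`. If `y ^ r` were a suffix of `w`, appending `y` would create `y ^ (r + 1)`; if `w`
    -- were a suffix of `y ^ r`, the word `w y` would begin with `y`.
    obtain ⟨E', j', e', hj', he', h1', h2'⟩ := exists_extend E e a (by
      rintro rfl
      rw [hpow]
      refine h2 _ ?_ ?_
      · rintro ⟨s, rfl⟩
        refine hy ⟨s, [], ?_⟩
        simp [List.replicate_succ']
      · intro h
        obtain ⟨v, hv⟩ : ∃ v, w ++ [1] = 1 :: v := by
          cases w with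
          | nil => exact ⟨[], rfl⟩
          | cons c w =>
            have := List.eq_of_mem_replicate (h.subset (List.mem_cons_self (a := c) (l := w)))
            exact ⟨w ++ [1], by rw [this]; rfl⟩
        exact hw v hv) (n - (w ++ [a]).length) (by
        rw [List.length_append, List.length_singleton]
        push_cast
        convert he using 1
        ring_nf)
    have hcat : ∀ (v : List (Fin 2)) (c : Fin 2),
        word k r (v ++ [c]) • e' = if c = a then j'.lin (word k r v • e) else 0 := by
      intro v c
      have h1 : word k r (v ++ [c]) = word k r v * gen k r c := by simp [word]
      rw [h1, mul_smul]
      split_ifs with h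
      · rw [h, h1', map_smul]
      · rw [h2' c h, smul_zero]
    refine ⟨E', j ≫ j', e', MorphismProperty.comp_mem _ _ _ hj hj', he', ?_, ?_⟩
    · rw [hcat, if_pos rfl, h1]
      rfl
    · intro v hv hv'
      obtain rfl | ⟨v, c, rfl⟩ := List.eq_nil_or_concat v
      · exact absurd (List.nil_suffix) hv
      · rw [List.concat_eq_append] at hv hv' ⊢
        rw [hcat]
        split_ifs with h
        · subst h
          rw [h2 v, map_zero]
          · rintro ⟨s, rfl⟩; exact hv ⟨s, by simp⟩
          · rintro ⟨s, rfl⟩; exact hv' ⟨s, by simp⟩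
        · rfl

end GrMod

/-! ### The quotient functor and generators of `QGr B` -/

open GrMod

variable (k r) in
/-- The quotient functor from graded modules to `QGr B`. -/
abbrev toQGr : GrMod.{u, u} (grading k r) ⥤ QGr k r :=
  (fdim.{u, u} (grading k r)).isoModSerre.Q

lemma toQGr_map_eq_zero_iff {M N : GrMod.{u, u} (grading k r)} (f : M ⟶ N) :
    (toQGr k r).map f = 0 ↔ ∀ m : M, N.IsTorsion (f.lin m) := by
  rw [ObjectProperty.SerreClassLocalization.map_eq_zero_iff (toQGr k r)
    (fdim.{u, u} (grading k r)), fdim_image_iff]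

lemma isIso_toQGr_map {M N : GrMod.{u, u} (grading k r)} {f : M ⟶ N}
    (hf : (fdim.{u, u} (grading k r)).isoModSerre f) : IsIso ((toQGr k r).map f) :=
  Localization.inverts (toQGr k r) _ f hf

instance : (toQGr k r).EssSurj := Localization.essSurj _ (fdim.{u, u} (grading k r)).isoModSerre

lemma isTorsion_of_toQGr_map_desc {n : ℤ} {M : GrMod.{u, u} (grading k r)} {m : M}
    {hm : m ∈ M.deg n} (h : (toQGr k r).map (desc m hm) = 0) : M.IsTorsion m := by
  have h1 := (toQGr_map_eq_zero_iff _).1 h (1 : B k r)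
  have e : (desc m hm).lin (1 : B k r) = m := one_smul _ m
  exact e ▸ h1

/-- Multiplying a homogeneous element by sufficiently long words moves it to degrees at least `n₀`,
where the hypothesis applies, and `IsTorsion.of_words` brings torsion back down. -/
lemma toQGr_map_eq_zero_of_free {M N : GrMod.{u, u} (grading k r)} (f : M ⟶ N) (n₀ : ℤ)
    (h : ∀ (n : ℤ) (u : free k r n ⟶ M), n₀ ≤ n → (toQGr k r).map (u ≫ f) = 0) :
    (toQGr k r).map f = 0 := by
  rw [toQGr_map_eq_zero_iff]
  intro m
  obtain ⟨s, hs⟩ := exists_sum m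
  rw [hs, map_sum]
  refine IsTorsion.sum _ _ fun i _ => IsTorsion.of_words (n₀ - i).toNat fun w hw => ?_
  have h1 := h (w.length + i) (desc _ (M.smul_mem (word_mem k r w) (proj_mem i m))) (by omega)
  rw [desc_comp] at h1
  rw [← map_smul]
  exact isTorsion_of_toQGr_map_desc h1

/-- The free modules generated in large degrees generate `QGr B`. -/
lemma eq_zero_of_free {X Y : QGr k r} (g : X ⟶ Y) (n₀ : ℤ)
    (h : ∀ (n : ℤ) (u : (toQGr k r).obj (free k r n) ⟶ X), n₀ ≤ n → u ≫ g = 0) : g = 0 := by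
  let eX := (toQGr k r).objObjPreimageIso X
  let eY := (toQGr k r).objObjPreimageIso Y
  -- Up to isomorphisms on both sides, `g` is the image of an actual homomorphism `φ.f` of graded
  -- modules.
  obtain ⟨φ, hφ⟩ := Localization.exists_leftFraction (toQGr k r)
    (fdim.{u, u} (grading k r)).isoModSerre (eX.hom ≫ g ≫ eY.inv)
  have := isIso_toQGr_map φ.hs
  have e : eX.hom ≫ g ≫ eY.inv ≫ (toQGr k r).map φ.s = (toQGr k r).map φ.f := by
    rw [← MorphismProperty.LeftFraction.map_comp_map_s φ (toQGr k r)
      (Localization.inverts _ _), ← hφ]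
    simp
  have h0 : (toQGr k r).map φ.f = 0 := toQGr_map_eq_zero_of_free _ n₀ fun n u hn => by
    rw [Functor.map_comp, ← e, ← Category.assoc, ← Category.assoc, h n _ hn, zero_comp]
  rw [h0] at e
  rw [← cancel_epi eX.hom, ← cancel_mono (eY.inv ≫ (toQGr k r).map φ.s)]
  simpa using e

/-- A morphism from a free module that is not a monomorphism kills a nonzero homogeneous element. -/
lemma exists_desc_comp_eq_zero {n : ℤ} {Y : QGr k r} (g : (toQGr k r).obj (free k r n) ⟶ Y)
    (hg : ¬ Mono g) : ∃ (m : ℤ) (b : B k r) (hb : b ∈ (free k r n).deg m), b ≠ 0 ∧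
      (toQGr k r).map (desc b hb) ≫ g = 0 := by
  rw [Preadditive.mono_iff_cancel_zero] at hg
  push Not at hg
  obtain ⟨W, z, hz, hz0⟩ := hg
  let e := (toQGr k r).objObjPreimageIso W
  -- A right fraction keeps the target free module unchanged, so the numerator `φ.f` takes its
  -- values in it; any nonzero homogeneous value can serve as `b`.
  obtain ⟨φ, hφ⟩ := Localization.exists_rightFraction (toQGr k r)
    (fdim.{u, u} (grading k r)).isoModSerre (e.hom ≫ z)
  have := isIso_toQGr_map φ.hs
  have hf : (toQGr k r).map φ.s ≫ e.hom ≫ z = (toQGr k r).map φ.f := by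
    rw [hφ, MorphismProperty.RightFraction.map_s_comp_map]
  have hf0 : φ.f ≠ 0 := fun h0 => hz0 (by
    rw [h0, Functor.map_zero] at hf
    rw [← cancel_epi e.hom, ← cancel_epi ((toQGr k r).map φ.s), hf, comp_zero, comp_zero])
  obtain ⟨i, x, hx, hx0⟩ : ∃ (i : ℤ) (x : φ.X'), x ∈ φ.X'.deg i ∧ φ.f.lin x ≠ 0 := by
    by_contra! hall
    refine hf0 (hom_ext fun x => ?_)
    obtain ⟨s, hs⟩ := exists_sum x
    rw [hs, map_sum]
    exact Finset.sum_eq_zero fun i _ => hall i _ (proj_mem i x)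
  refine ⟨i, φ.f.lin x, φ.f.map_deg i x hx, hx0, ?_⟩
  rw [← desc_comp x hx φ.f, Functor.map_comp, ← hf]
  simp only [Category.assoc, hz, comp_zero]

/-! ### Retractions through a homogeneous element -/

/-- A word containing `y ^ (r + 1)` is zero in `B`. -/
lemma word_eq_zero {w : List (Fin 2)} (h : List.replicate (r + 1) 1 <:+: w) : word k r w = 0 := by
  obtain ⟨s, t, rfl⟩ := h
  have h0 : word k r (List.replicate (r + 1) 1) = 0 := by
    rw [← mk_word, List.map_replicate, List.prod_replicate,
      RingQuot.mkAlgHom_rel (s := Rel k r) k ⟨rfl, rfl⟩, map_zero]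
  rw [word_append, word_append, h0, mul_zero, zero_mul]

/-- A run of `y` cannot meet the leading block of `x`. -/
lemma infix_of_infix_replicate_append {n j : ℕ} {w : List (Fin 2)}
    (h : List.replicate (n + 1) 1 <:+: List.replicate j 0 ++ w) :
    List.replicate (n + 1) 1 <:+: w := by
  induction j with
  | zero => simpa using h
  | succ j ih =>
    rw [List.replicate_succ (n := j), List.cons_append, List.infix_cons_iff] at h
    obtain h | h := h
    · rw [List.replicate_succ, List.cons_prefix_cons] at h
      exact absurd h.1 (by decide)
    · exact ih h

/-- For a nonzero homogeneous element `b` of degree `m` in a free module of rank one, all free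
modules generated in degrees above `m` embed, up to torsion, into the submodule generated by `b`, as
direct summands of the free module. -/
lemma exists_isIso_comp_desc_comp {n m : ℤ} {b : B k r} (hb : b ∈ (free k r n).deg m)
    (hb0 : b ≠ 0) {l : ℤ} (hl : m < l) :
    ∃ (i : free k r l ⟶ free k r m) (E : GrMod.{u, u} (grading k r)) (p : free k r n ⟶ E),
      IsIso ((toQGr k r).map (i ≫ desc b hb ≫ p)) := by
  classical
  have hb' : b ∈ Submodule.span k {b : B k r | ∃ w : List (Fin 2), (w.length : ℤ) = m - n ∧
    word k r w = b} := hb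
  have hset : {b : B k r | ∃ w : List (Fin 2), (w.length : ℤ) = m - n ∧ word k r w = b} =
      word k r '' {w | (w.length : ℤ) = m - n} := rfl
  rw [hset, Finsupp.mem_span_image_iff_linearCombination] at hb'
  obtain ⟨c, hc, rfl⟩ := hb'
  rw [Finsupp.mem_supported] at hc
  -- The expansion of `b` in words need not be unique; it is enough that some word occurring in it
  -- is nonzero in `B`, hence contains no `y ^ (r + 1)`.
  obtain ⟨w, hw, hw0⟩ : ∃ w ∈ c.support, word k r w ≠ 0 := by
    by_contra! hall
    refine hb0 ?_
    rw [Finsupp.linearCombination_apply]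
    exact Finset.sum_eq_zero fun w hw => by
      dsimp only
      rw [hall w hw, smul_zero]
  have hlen : ∀ v ∈ c.support, (v.length : ℤ) = m - n := fun v hv => hc hv
  -- The prefix `x ^ (l - m)` fixes the degree; since `l > m` it is nonempty, so the extended word
  -- begins with `x` as `exists_coefficient` requires.
  obtain ⟨j, rfl⟩ : ∃ j : ℕ, l = m + (j + 1 : ℕ) := ⟨(l - m - 1).toNat, by omega⟩
  let z : List (Fin 2) := List.replicate (j + 1) 0
  have hzl : z.length = j + 1 := List.length_replicate
  obtain ⟨E, q, e, hq, he, h1, h2⟩ := exists_coefficient (k := k) (r := r) (m + (j + 1 : ℕ))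
    (z ++ w) (by intro v hv; simp [z, List.replicate_succ] at hv) (by
      intro h
      refine hw0 (word_eq_zero (infix_of_infix_replicate_append h)))
  have hβ : (c w)⁻¹ • word k r z ∈ (free k r m).deg (m + (j + 1 : ℕ)) := by
    change _ ∈ grading k r _
    refine Submodule.smul_mem _ _ ?_
    have := word_mem k r z
    rw [hzl] at this
    rwa [add_sub_cancel_left]
  have he' : e ∈ E.deg n := by
    have hn : m + (j + 1 : ℕ) - (z ++ w).length = n := by
      have := hlen w hw
      rw [List.length_append, hzl]
      push_cast
      omega
    rwa [hn] at he
  refine ⟨desc ((c w)⁻¹ • word k r z : B k r) hβ, E, desc e he', ?_⟩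
  -- The generator goes to `(c w)⁻¹ • (z * b) • e`, in which only the term of `w` survives. So the
  -- composite is `q`, which is invertible modulo torsion.
  have key : desc ((c w)⁻¹ • word k r z : B k r) hβ ≫ desc _ hb ≫ desc e he' = q := by
    refine free_hom_ext ?_
    change ((1 * ((c w)⁻¹ • word k r z)) * Finsupp.linearCombination k (word k r) c) • e = _
    have hcw : c w ≠ 0 := Finsupp.mem_support_iff.1 hw
    rw [one_mul, smul_mul_assoc, smul_assoc, Finsupp.linearCombination_apply, Finsupp.sum,
      Finset.mul_sum, Finset.sum_smul, Finset.sum_eq_single_of_mem w hw]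
    · rw [mul_smul_comm, ← word_append, smul_assoc, h1, smul_smul, inv_mul_cancel₀ hcw, one_smul]
    · intro v hv hvw
      -- For words of equal length, being a suffix means being equal.
      have hl : (z ++ v).length = (z ++ w).length := by
        have h3 := hlen v hv
        have h4 := hlen w hw
        rw [List.length_append, List.length_append]
        omega
      have hne : z ++ v ≠ z ++ w := fun h => hvw (List.append_cancel_left h)
      rw [mul_smul_comm, ← word_append, smul_assoc, h2 _ (fun h => hne (h.eq_of_length hl))
        (fun h => hne (h.eq_of_length hl.symm).symm), smul_zero]
  rw [key]
  exact isIso_toQGr_map hq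

/-! ### The dichotomy -/

/-- A closed subspace of `Proj_nc B` is everything or empty. -/
lemma eq_top_or_eq_isZero_of_isClosedSubspace {P : ObjectProperty (QGr k r)}
    (hP : IsClosedSubspace P) :
    P = ⊤ ∨ P = fun X => IsZero X := by
  have := hP.sub
  have := hP.quot
  have := hP.hasRightAdjoint
  have := hP.hasLeftAdjoint
  let F := P.ι.leftAdjoint
  let adj : F ⊣ P.ι := Adjunction.ofIsRightAdjoint P.ι
  let η : ∀ n, (toQGr k r).obj (free k r n) ⟶ P.ι.obj (F.obj ((toQGr k r).obj (free k r n))) :=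
    fun n => adj.unit.app _
  -- The universal property of the reflection: morphisms to objects of `P` factor through the unit.
  have hη : ∀ (n : ℤ) (T : QGr k r) (_ : P T) (g : (toQGr k r).obj (free k r n) ⟶ T),
      ∃ g', g = η n ≫ g' := fun n T hT g =>
    ⟨P.ι.map ((adj.homEquiv _ (⟨T, hT⟩ : P.FullSubcategory)).symm g), by
      have := (adj.homEquiv _ (⟨T, hT⟩ : P.FullSubcategory)).apply_symm_apply g
      rw [Adjunction.homEquiv_unit] at this
      exact this.symm⟩
  by_cases hmono : ∀ n, Mono (η n)
  · left
    refine eq_top_iff.2 fun X _ => ?_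
    let G := P.ι.rightAdjoint
    let adj' : P.ι ⊣ G := Adjunction.ofIsLeftAdjoint P.ι
    let ε : P.ι.obj (G.obj X) ⟶ X := adj'.counit.app X
    have hε : Epi ε := by
      rw [Preadditive.epi_iff_cancel_zero]
      intro Z q hq
      refine eq_zero_of_free q 0 fun n u _ => ?_
      have := hmono n
      have hPn : P ((toQGr k r).obj (free k r n)) := P.prop_of_mono (η n) (F.obj _).property
      have e := (adj'.homEquiv (⟨_, hPn⟩ : P.FullSubcategory) X).symm_apply_apply u
      -- With the free module in `P`, each `u` factors through the counit `ε`, which `q` kills.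
      rw [Adjunction.homEquiv_counit] at e
      rw [← e, Category.assoc]
      exact (congrArg _ hq).trans comp_zero
    exact P.prop_of_epi ε (G.obj X).property
  · right
    push Not at hmono
    obtain ⟨n, hn⟩ := hmono
    obtain ⟨m, b, hb, hb0, hbη⟩ := exists_desc_comp_eq_zero _ hn
    funext X
    refine propext ⟨fun hX => ?_, fun hX => ?_⟩
    · rw [IsZero.iff_id_eq_zero]
      -- The retraction exists only for `l > m`, hence the threshold `m + 1`.
      refine eq_zero_of_free _ (m + 1) fun l u hl => ?_
      rw [Category.comp_id]
      obtain ⟨i, E, p, hi⟩ := exists_isIso_comp_desc_comp hb hb0 (show m < l by omega)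
      -- This extends `u` along the retraction to the free module in degree `n`; its factorization
      -- through `η n` then forces `u = 0`, because `b` is killed by `η n`.
      obtain ⟨g', hg'⟩ := hη n X hX
        ((toQGr k r).map p ≫ inv ((toQGr k r).map (i ≫ desc b hb ≫ p)) ≫ u)
      rw [← IsIso.hom_inv_id_assoc ((toQGr k r).map (i ≫ desc b hb ≫ p)) u]
      nth_rw 1 [Functor.map_comp, Functor.map_comp]
      rw [Category.assoc, Category.assoc, hg', reassoc_of% hbη, zero_comp, comp_zero]
    -- Zero objects lie in `P` as subobjects of any reflection `F.obj X`.
    · have : Mono (0 : X ⟶ P.ι.obj (F.obj X)) := hX.mono _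
      exact P.prop_of_mono (0 : X ⟶ P.ι.obj (F.obj X)) (F.obj X).property

end QGr

/-! ### The two trivial closed subspaces -/

section

variable {C : Type*} [Category* C]

lemma isClosedSubspace_top : IsClosedSubspace (⊤ : ObjectProperty C) where
  sub := ⟨fun _ _ _ => trivial⟩
  quot := ⟨fun _ _ _ => trivial⟩
  hasRightAdjoint := (ObjectProperty.topEquivalence C).toAdjunction.isLeftAdjoint
  hasLeftAdjoint := (ObjectProperty.topEquivalence C).symm.toAdjunction.isRightAdjoint

/-- All morphism sets involved are singletons, so the constant functor at a zero object is adjoint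
to the inclusion on both sides. -/
lemma isClosedSubspace_isZero [Preadditive C] [HasZeroObject C] :
    IsClosedSubspace (fun X : C => IsZero X) := by
  let P : ObjectProperty C := fun X => IsZero X
  let Z : P.FullSubcategory := ⟨_, (HasZeroObject.zero (C := C)).choose_spec⟩
  let F : C ⥤ P.FullSubcategory := (Functor.const C).obj Z
  have hP : ∀ Y : P.FullSubcategory, IsZero Y := fun Y =>
    IsZero.of_full_of_faithful_of_isZero P.ι _ Y.property
  exact {
    sub := ⟨fun f _ hY => IsZero.of_mono f hY⟩
    quot := ⟨fun f _ hX => IsZero.of_epi f hX⟩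
    hasRightAdjoint := (Adjunction.mkOfHomEquiv (F := P.ι) (G := F)
      { homEquiv := fun Y X =>
          { toFun := fun _ => (hP Y).to_ _
            invFun := fun _ => Y.property.to_ _
            left_inv := fun _ => Y.property.eq_of_src _ _
            right_inv := fun _ => (hP Y).eq_of_src _ _ }
        homEquiv_naturality_left_symm := fun {Y _ _} _ _ =>
          Y.property.eq_of_src _ _
        homEquiv_naturality_right := fun _ _ => (hP _).eq_of_src _ _ }).isLeftAdjoint
    hasLeftAdjoint := (Adjunction.mkOfHomEquiv (F := F) (G := P.ι)
      { homEquiv := fun X Y =>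
          { toFun := fun _ => Y.property.from_ _
            invFun := fun _ => (hP Y).from_ _
            left_inv := fun _ => (hP Y).eq_of_tgt _ _
            right_inv := fun _ => Y.property.eq_of_tgt _ _ }
        homEquiv_naturality_left_symm := fun _ _ => (hP _).eq_of_tgt _ _
        homEquiv_naturality_right := fun {_ _ Y} _ _ =>
          Y.property.eq_of_tgt _ _ }).isRightAdjoint }

end

end NCProj

theorem mainTheorem12 {k : Type u} [Field k] (r : ℕ) (hr : 1 ≤ r)
    (P : ObjectProperty (NCProj.QGr k r)) :
    NCProj.IsClosedSubspace P ↔ P = ⊤ ∨ P = (fun X => IsZero X) := by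
  refine ⟨NCProj.eq_top_or_eq_isZero_of_isClosedSubspace, ?_⟩
  rintro (rfl | rfl)
  · exact NCProj.isClosedSubspace_top
  · exact NCProj.isClosedSubspace_isZero
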